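/- Let $d\ge 0$ and let $q_1,\dots,q_d\ge 1$ be polynomial degrees. For $q\ge1$ let $\mathcal G_q\subset[-1,1]$ be the set of the $q+1$ Gauss–Lobatto nodes ($\pm1$ and the zeros of $P_q'$, with $P_q$ the Legendre polynomial), with Lagrange polynomials $\ell_a$ and weights $\int_{-1}^1\ell_a$ ($a\in\mathcal G_q$). On the reference element $\hat\Omega=[-1,1]^d$ let $\hat x_k$, $\hat w_k$, $\hat\varphi_k$, $k\in\mathcal G_{q_1}\times\dots\times\mathcal G_{q_d}$, be the tensor-product nodes, weights and Lagrange basis functions. Consider a finite mesh of elements $\Omega_e=F_e(\hat\Omega)\subset\mathbb R^d$, where the $F_e$ are bijective affine maps with Jacobian $J_e$ and the elements have pairwise disjoint interiors, and set $\Omega=\bigcup_e\Omega_e$. The mesh is $C^0$-conforming: for every point $z$, the shape functions attached to $z$ on the elements ($\hat\varphi_k\circ F_e^{-1}$ if $z=F_e(\hat x_k)$, and $0$ if $z$ is not a node of $\Omega_e$) coincide wherever two elements meet, and so define a global nodal basis function $\varphi_z$. Let $\Gamma\subset\mathbb R^d$ be any set of Dirichlet points (e.g. $\Gamma=\emptyset$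 or $\Gamma=\partial\Omega$), and let $x_1,\dots,x_n$ be the distinct points among the nodes $F_e(\hat x_k)$ that do not lie in $\Gamma$, with basis functions $\varphi_1,\dots,\varphi_n$. Let $\kappa>0$ be integrable on $\Omega$, and let the density $\rho$ be equal to a constant $\rho_e>0$ in the interior of each element $\Omega_e$. Define the stiffness matrix, the consistent mass matrix and the nodal-quadrature lumped mass matrix by $$K_{ij}=\int_\Omega\kappa\,\nabla\varphi_i\cdot\nabla\varphi_j\,dx,\qquad M_{ij}=\int_\Omega\rho\,\varphi_i\varphi_j\,dx,\qquad \widehat M_{ij}=\sum_e\sum_k \hat w_k\,\rho_e\,|\det J_e|\,\varphi_i(F_e(\hat x_k))\,\varphi_j(F_e(\hat x_k)).$$ Then $M$ and $\widehat M$ are positive definite and $\widehat M\succeq M$, i.e. $\widehat M-M$ is positive semidefinite. The pairs $(K,M)$ and $(K,\widehat M)$ each have exactly $n$ real generalized eigenvalues, counted with multiplicity as zeros of $\lambda\mapsto\det(K-\lambda M)$ and $\lambda\mapsto\det(K-\lambda\widehat M)$. In nondecreasing order these satisfy $$\lambda_k(K,\widehat M)\le\lambda_k(K,M),\qquad k=1,\dots,n.$$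 Consequently the critical time step of the explicit central difference scheme does not shrink: $2/\sqrt{\lambda_n(K,M)}\le 2/\sqrt{\lambda_n(K,\widehat M)}$ (read as $+\infty$ where the eigenvalue is $0$, and trivial if $n=0$). -/

import Mathlib

noncomputable section

namespace SpectralFEM

open Polynomial

/-! ## One-dimensional Gauss-Lobatto rule and Lagrange basis on the interval from -1 to 1 -/

/-- The Legendre polynomial `P_q` (Rodrigues' formula). -/
def legendre (q : ℕ) : ℝ[X] :=
  C (1 / (2 ^ q * (q.factorial : ℝ))) * derivative^[q] ((X ^ 2 - 1) ^ q)

open Classical in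
/-- The Gauss-Lobatto nodes of degree `q ≥ 1`: the points `-1`, `1` and the zeros of `P_q'`. -/
def glNodes (q : ℕ) : Finset ℝ :=
  ((X ^ 2 - 1) * derivative (legendre q)).roots.toFinset

open Classical in
/-- The Lagrange polynomial of degree `q` attached to the Gauss-Lobatto node `a`:
the product of `(X - b) / (a - b)` over all the other Gauss-Lobatto nodes `b`. -/
def glLagrange (q : ℕ) (a : glNodes q) : ℝ[X] :=
  Lagrange.basis (glNodes q) id (a : ℝ)

/-- The Gauss-Lobatto weight of the node `a` (the rule is interpolatory). -/
def glWeight (q : ℕ) (a : glNodes q) : ℝ :=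
  ∫ t in (-1 : ℝ)..1, (glLagrange q a).eval t

/-! ## The tensor-product reference element -/

/-- The reference element `[-1, 1]^d`. -/
def refCube (d : ℕ) : Set (EuclideanSpace ℝ (Fin d)) :=
  {x | ∀ j, x j ∈ Set.Icc (-1 : ℝ) 1}

/-- Local multi-indices: one Gauss-Lobatto node in each of the `d` directions
(the degree in direction `j` is `q j`). -/
abbrev LocalIndex {d : ℕ} (q : Fin d → ℕ) : Type :=
  (j : Fin d) → glNodes (q j)

variable {d : ℕ} {q : Fin d → ℕ}

/-- Reference quadrature node with multi-index `k`. -/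
def refNode (k : LocalIndex q) : EuclideanSpace ℝ (Fin d) :=
  WithLp.toLp 2 fun j => (k j : ℝ)

/-- Reference quadrature weight with multi-index `k`. -/
def refWeight (k : LocalIndex q) : ℝ :=
  ∏ j, glWeight (q j) (k j)

/-- Reference (tensor-product Lagrange) shape function with multi-index `k`. -/
def refBasis (k : LocalIndex q) (x : EuclideanSpace ℝ (Fin d)) : ℝ :=
  ∏ j, (glLagrange (q j) (k j)).eval (x j)

open Classical in
/-- The shape function, on the element with affine map `F`, that is attached to the point `z`:
it is `refBasis k ∘ F⁻¹` if `z = F (refNode k)` is a node of the element, and `0` if `z` is not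
a node of the element. -/
def elementBasis (q : Fin d → ℕ)
    (F : EuclideanSpace ℝ (Fin d) ≃ᵃ[ℝ] EuclideanSpace ℝ (Fin d))
    (z x : EuclideanSpace ℝ (Fin d)) : ℝ :=
  ∑ k : LocalIndex q, if F (refNode k) = z then refBasis k (F.symm x) else 0

/-! ## Meshes, global nodal basis, bilinear forms -/

/-- A mesh of affine tensor-product spectral elements with `q j` the degree in direction `j`.
Each element is the image of the reference element under a bijective affine map. -/
structure Mesh (d : ℕ) (q : Fin d → ℕ) (E : Type*) where
  /-- the affine map from the reference element to the element `e` -/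
  map : E → (EuclideanSpace ℝ (Fin d) ≃ᵃ[ℝ] EuclideanSpace ℝ (Fin d))
  /-- the elements do not overlap -/
  disjoint_interior : Pairwise fun e e' =>
    Disjoint (interior (map e '' refCube d)) (interior (map e' '' refCube d))
  /-- the mesh is `C⁰`-conforming: where two elements meet, the shape functions that they attach
  to the same point agree, so that they can be glued together to global functions -/
  conforming : ∀ e e' x, x ∈ map e '' refCube d → x ∈ map e' '' refCube d →
    ∀ z, elementBasis q (map e) z x = elementBasis q (map e') z x

namespace Mesh

variable {E : Type*} (T : Mesh d q E)

/-- The (closed) physical element `e`. -/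
def element (e : E) : Set (EuclideanSpace ℝ (Fin d)) := T.map e '' refCube d

/-- The (closed) physical domain, the union of the elements. -/
def domain : Set (EuclideanSpace ℝ (Fin d)) := ⋃ e, T.element e

/-- `|det J_e|`, with `J_e` the Jacobian of the affine map of the element `e`. -/
def absJac (e : E) : ℝ :=
  |LinearMap.det ((T.map e).linear :
    EuclideanSpace ℝ (Fin d) →ₗ[ℝ] EuclideanSpace ℝ (Fin d))|

open Classical in
/-- The global nodal basis function attached to the node `z`, glued together from the element
shape functions (and set to `0` outside the domain). -/
def basis (z x : EuclideanSpace ℝ (Fin d)) : ℝ :=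
  if h : ∃ e, x ∈ T.element e then elementBasis q (T.map h.choose) z x else 0

/-- The gluing does not depend on choices: on every element `e`, the global basis function is the
shape function of `e`. -/
theorem basis_eq_elementBasis (z : EuclideanSpace ℝ (Fin d)) {x : EuclideanSpace ℝ (Fin d)}
    {e : E} (hx : x ∈ T.element e) : T.basis z x = elementBasis q (T.map e) z x := by
  have h : ∃ e, x ∈ T.element e := ⟨e, hx⟩
  unfold basis
  rw [dif_pos h]
  exact T.conforming _ _ x h.choose_spec hx z

open Classical in
/-- The nodes that carry the degrees of freedom: the images of all the reference nodes in all the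
elements (a node shared by several elements counts once), without those that lie in the set `Γ`
where homogeneous Dirichlet conditions are imposed. -/
def freeNodes [Fintype E] (Γ : Set (EuclideanSpace ℝ (Fin d))) :
    Finset (EuclideanSpace ℝ (Fin d)) :=
  (Finset.univ.image fun p : E × LocalIndex q => T.map p.1 (refNode p.2)).filter (· ∉ Γ)

/-- Stiffness form `a(u, v) = ∫_Ω κ ∇u · ∇v`. -/
def stiffForm (κ u v : EuclideanSpace ℝ (Fin d) → ℝ) : ℝ :=
  ∫ x in T.domain, κ x * inner ℝ (gradient u x) (gradient v x)

/-- Consistent mass form `b(u, v) = ∫_Ω ρ u v`. -/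
def massForm (ρ u v : EuclideanSpace ℝ (Fin d) → ℝ) : ℝ :=
  ∫ x in T.domain, ρ x * u x * v x

/-- Lumped mass form: the elementwise Gauss-Lobatto nodal quadrature of the mass form, for a
density that takes the constant value `ρe e` on the element `e`. -/
def lumpedForm [Fintype E] (ρe : E → ℝ) (u v : EuclideanSpace ℝ (Fin d) → ℝ) : ℝ :=
  ∑ e, ∑ k : LocalIndex q, refWeight k * ρe e * T.absJac e *
    u (T.map e (refNode k)) * v (T.map e (refNode k))

variable [Fintype E] (Γ : Set (EuclideanSpace ℝ (Fin d)))

/-- Stiffness matrix `K`. -/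
def stiffMatrix (κ : EuclideanSpace ℝ (Fin d) → ℝ) :
    Matrix (T.freeNodes Γ) (T.freeNodes Γ) ℝ :=
  Matrix.of fun i j => T.stiffForm κ (T.basis i) (T.basis j)

/-- Consistent mass matrix `M`. -/
def massMatrix (ρ : EuclideanSpace ℝ (Fin d) → ℝ) :
    Matrix (T.freeNodes Γ) (T.freeNodes Γ) ℝ :=
  Matrix.of fun i j => T.massForm ρ (T.basis i) (T.basis j)

/-- Nodal-quadrature lumped mass matrix. -/
def lumpedMatrix (ρe : E → ℝ) : Matrix (T.freeNodes Γ) (T.freeNodes Γ) ℝ :=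
  Matrix.of fun i j => T.lumpedForm ρe (T.basis i) (T.basis j)

end Mesh

/-! ## Generalized eigenvalues -/

section GenEig

variable {n : Type*} [Fintype n]

open Classical in
/-- The real generalized eigenvalues of the pair `(A, B)`, that is, the real zeros of
`det (A - t B)` with multiplicity, as a nondecreasing list. -/
def genEigList (A B : Matrix n n ℝ) : List ℝ :=
  ((A.map C - (X : ℝ[X]) • B.map C).det.roots).sort (· ≤ ·)

/-- The `k`-th smallest generalized eigenvalue, with `k` counted from `0`. -/
def genEig (A B : Matrix n n ℝ) (k : ℕ) : ℝ := (genEigList A B).getD k 0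

/-- The critical time step `2 / √λ_max` of the explicit central difference scheme for
`B u'' + A u = f` (infinite if `λ_max` is zero). -/
def criticalTimeStep (A B : Matrix n n ℝ) : ENNReal :=
  2 / ENNReal.ofReal (Real.sqrt (genEig A B (Fintype.card n - 1)))

end GenEig

end SpectralFEM

end

noncomputable section

namespace SpectralFEM

section

open Polynomial

/-! ## Gauss-Lobatto nodes -/

/-! The heart is one-dimensional: for `p` of degree at most `q`, the Gauss-Lobatto rule
overestimates `∫ p²` (`integral_sq_le_sum_glWeight`). Divide `p² = r + W g` by the monic nodal
polynomial `W`. The rule sees only `r` and is exact on it, so `∫ p²` differs from the quadrature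
value by `∫ W g`. Here `W` is a positive multiple of the `(q-1)`-th derivative of `(X² - 1)^q`, and
`q - 1` integrations by parts leave `(-1)^(q-1) (X² - 1)^q ≤ 0` against a nonnegative constant.

In matrix terms, the diagonal weight matrix dominates the 1D mass matrix. The Schur product theorem
carries this to tensor products (`posSemidef_prod_sub_prod`). Both global mass matrices are sums
over elements of the same congruences of the reference matrices, with positive factors, so the
Loewner order survives assembly.

The eigenvalue comparison is a Courant-Fischer argument in counting form: enlarging the right-hand
matrix cannot lower the number of eigenvalues `≤ t` for `t ≥ 0`
(`card_eigenvalue_le_of_posSemidef_sub`). Since `K` is positive semidefinite, nonnegative `t`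
suffice. -/

/-- The `k`-th derivative of `(X ^ 2 - 1) ^ q`. -/
def rodrigues (q k : ℕ) : ℝ[X] := derivative^[k] ((X ^ 2 - 1) ^ q)

theorem derivative_rodrigues (q k : ℕ) : derivative (rodrigues q k) = rodrigues q (k + 1) := by
  simp [rodrigues, Function.iterate_succ_apply']

/-- Differentiate `(x² - 1) y' = 2 q x y`, satisfied by `y = (x² - 1)^q`, a total of `k + 1` times.
At `k = q - 1` the middle term vanishes, which identifies the Gauss-Lobatto nodes in `glNodes_eq`.
-/
theorem rodrigues_recurrence (q k : ℕ) :
    (X ^ 2 - 1) * rodrigues q (k + 2) =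
      C (2 * (q : ℝ) - 2 * (k + 1)) * X * rodrigues q (k + 1)
        + C ((k + 1) * (2 * (q : ℝ) - k)) * rodrigues q k := by
  induction k with
  | zero =>
    have h : (X ^ 2 - 1) * rodrigues q 1 = C (2 * (q : ℝ)) * X * rodrigues q 0 := by
      rcases q with _ | n
      · simp [rodrigues]
      · simp only [rodrigues, Function.iterate_one, Function.iterate_zero, id, derivative_pow,
          derivative_sub, derivative_one, derivative_X]
        simp only [Nat.add_sub_cancel, map_mul, map_natCast, map_ofNat]
        ring
    have h' := congrArg derivative h
    simp only [derivative_mul, derivative_rodrigues, derivative_sub, derivative_pow,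
      derivative_X, derivative_one, derivative_C] at h'
    simp only [map_sub, map_mul, map_natCast, map_ofNat, map_one, Nat.cast_zero,
      zero_add] at h' ⊢
    norm_num at h' ⊢
    linear_combination h'
  | succ k ih =>
    have h' := congrArg derivative ih
    simp only [derivative_mul, derivative_rodrigues, derivative_sub, derivative_pow, derivative_add,
      derivative_X, derivative_one, derivative_C] at h'
    simp only [map_sub, map_mul, map_add, map_natCast, map_ofNat, map_one, Nat.cast_add,
      Nat.cast_one] at h' ⊢
    norm_num at h' ⊢
    linear_combination h'

theorem natDegree_sq_sub_one_pow (q : ℕ) : ((X ^ 2 - 1 : ℝ[X]) ^ q).natDegree = 2 * q := by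
  have : (X ^ 2 - 1 : ℝ[X]).natDegree = 2 := by compute_degree!
  rw [natDegree_pow, this, mul_comm]

theorem coeff_rodrigues_pos {q k m : ℕ} (h : m + k = 2 * q) : 0 < (rodrigues q k).coeff m := by
  have hm : ((X ^ 2 - 1 : ℝ[X]) ^ q).Monic := by
    apply Monic.pow
    have : (X ^ 2 - 1 : ℝ[X]) = X ^ 2 - C 1 := by simp
    rw [this]
    exact monic_X_pow_sub_C _ (by norm_num)
  have hc : ((X ^ 2 - 1 : ℝ[X]) ^ q).coeff (m + k) = 1 := by
    rw [h, ← natDegree_sq_sub_one_pow]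
    exact hm
  rw [rodrigues, coeff_iterate_derivative, hc, nsmul_eq_mul, mul_one, Nat.cast_pos]
  exact Nat.descFactorial_pos.2 (by omega)

theorem rodrigues_ne_zero {q k : ℕ} (h : k ≤ 2 * q) : rodrigues q k ≠ 0 := fun h0 => by
  have := coeff_rodrigues_pos (q := q) (k := k) (m := 2 * q - k) (by omega)
  simp [h0] at this

theorem natDegree_rodrigues_le (q k : ℕ) : (rodrigues q k).natDegree ≤ 2 * q - k := by
  have := natDegree_iterate_derivative ((X ^ 2 - 1 : ℝ[X]) ^ q) k
  rwa [natDegree_sq_sub_one_pow] at this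

theorem eval_rodrigues_eq_zero {q k : ℕ} (h : k < q) {x : ℝ} (hx : x ^ 2 = 1) :
    (rodrigues q k).eval x = 0 := by
  have h1 : (X ^ 2 - 1 : ℝ[X]) ∣ rodrigues q k :=
    (dvd_pow_self _ (by omega)).trans (pow_sub_dvd_iterate_derivative_pow _ q k)
  exact eval_eq_zero_of_dvd_of_eval_eq_zero h1 (by simp [hx])

/-- Rolle: a polynomial with `m` distinct real roots has at least `m - 1` roots of its derivative
outside them. As long as `k < q` the points `±1` remain roots, and they are not among those new
ones, so each derivative gains at least one root. -/
theorem le_card_roots_rodrigues {q k : ℕ} (h : k < q) :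
    k + 2 ≤ (rodrigues q k).roots.toFinset.card := by
  have hpm : ∀ k < q, ({1, -1} : Finset ℝ) ⊆ (rodrigues q k).roots.toFinset := by
    intro k hk x hx
    rw [Multiset.mem_toFinset, mem_roots (rodrigues_ne_zero (by omega))]
    apply eval_rodrigues_eq_zero hk
    simp only [Finset.mem_insert, Finset.mem_singleton] at hx
    rcases hx with rfl | rfl <;> norm_num
  have h2 : ({1, -1} : Finset ℝ).card = 2 := Finset.card_pair (by norm_num)
  induction k with
  | zero => simpa [h2] using Finset.card_le_card (hpm 0 h)
  | succ k ih =>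
    have hr := (rodrigues q k).card_roots_toFinset_le_card_roots_derivative_sdiff_roots_succ
    rw [derivative_rodrigues] at hr
    have hd : Disjoint ((rodrigues q (k + 1)).roots.toFinset \ (rodrigues q k).roots.toFinset)
        ({1, -1} : Finset ℝ) :=
      Finset.disjoint_of_subset_right (hpm k (by omega)) Finset.sdiff_disjoint
    have := Finset.card_le_card (Finset.union_subset
      (Finset.sdiff_subset (s := (rodrigues q (k + 1)).roots.toFinset)
        (t := (rodrigues q k).roots.toFinset)) (hpm _ h))
    rw [Finset.card_union_of_disjoint hd, h2] at this
    have := ih (by omega)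
    omega

theorem glNodes_eq {q : ℕ} (hq : 1 ≤ q) : glNodes q = (rodrigues q (q - 1)).roots.toFinset := by
  obtain ⟨n, rfl⟩ : ∃ n, q = n + 1 := ⟨q - 1, by omega⟩
  have hrec := rodrigues_recurrence (n + 1) n
  have hc : (1 / (2 ^ (n + 1) * ((n + 1).factorial : ℝ))) ≠ 0 := by positivity
  have hc2 : ((n + 1 : ℝ) * (2 * ((n + 1 : ℕ) : ℝ) - n)) ≠ 0 := by
    push_cast
    have : (0 : ℝ) < 2 * (n + 1) - n := by linarith [(Nat.cast_nonneg n : (0 : ℝ) ≤ n)]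
    positivity
  have : (X ^ 2 - 1) * derivative (legendre (n + 1)) =
      C (1 / (2 ^ (n + 1) * ((n + 1).factorial : ℝ))) *
        (C ((n + 1 : ℝ) * (2 * ((n + 1 : ℕ) : ℝ) - n)) * rodrigues (n + 1) n) := by
    have h0 : (2 * ((n + 1 : ℕ) : ℝ) - 2 * (n + 1)) = 0 := by push_cast; ring
    rw [h0, C_0, zero_mul, zero_mul, zero_add] at hrec
    rw [← hrec, legendre, derivative_C_mul]
    change _ * (C _ * derivative (rodrigues (n + 1) (n + 1))) = _
    rw [derivative_rodrigues]
    ring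
  rw [glNodes, this, roots_C_mul _ hc, roots_C_mul _ hc2, Nat.add_sub_cancel]

theorem card_glNodes {q : ℕ} (hq : 1 ≤ q) : (glNodes q).card = q + 1 := by
  rw [glNodes_eq hq]
  apply le_antisymm
  · calc _ ≤ _ := Multiset.toFinset_card_le _
      _ ≤ _ := card_roots' _
      _ ≤ _ := natDegree_rodrigues_le _ _
      _ ≤ _ := by omega
  · have := le_card_roots_rodrigues (q := q) (k := q - 1) (by omega)
    omega

/-- The degree is `q + 1` and there are `q + 1` distinct roots, so all are simple. The sign of `c`
decides the sign of the quadrature error. -/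
theorem rodrigues_eq_mul_nodal {q : ℕ} (hq : 1 ≤ q) :
    ∃ c : ℝ, 0 < c ∧ rodrigues q (q - 1) = C c * Lagrange.nodal (glNodes q) id := by
  set r := rodrigues q (q - 1)
  have hdeg : r.natDegree ≤ q + 1 := (natDegree_rodrigues_le _ _).trans (by omega)
  have hpos := coeff_rodrigues_pos (q := q) (k := q - 1) (m := q + 1) (by omega)
  have hcard : r.roots.toFinset.card = q + 1 := by rw [← card_glNodes hq, glNodes_eq hq]
  have h1 := Multiset.toFinset_card_le r.roots
  have h2 := card_roots' r
  have hdeg' : r.natDegree = q + 1 := by omega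
  have hnodup : r.roots.Nodup := by
    rw [← Multiset.toFinset_card_eq_card_iff_nodup]
    omega
  refine ⟨r.leadingCoeff, ?_, ?_⟩
  · rw [leadingCoeff, hdeg']
    exact hpos
  · conv_lhs => rw [← C_leadingCoeff_mul_prod_multiset_X_sub_C (p := r) (by omega)]
    rw [Lagrange.nodal_eq, glNodes_eq hq, Finset.prod, Multiset.toFinset_val,
      hnodup.dedup]
    rfl

/-- Gauss-Lucas: the zeros of a derivative lie in the convex hull of the zeros, and differentiation
starts from the zeros `±1`. This places the nodes in `[-1, 1]`. -/
theorem rodrigues_aeval_complex_eq_zero {q k : ℕ} (hk : k < 2 * q) {z : ℂ}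
    (hz : aeval z (rodrigues q k) = 0) : z ∈ Complex.ofRealCLM '' Set.Icc (-1 : ℝ) 1 := by
  induction k generalizing z with
  | zero =>
    have hq : q ≠ 0 := by omega
    simp only [rodrigues, Function.iterate_zero, id, map_pow, map_sub, aeval_X, map_one,
      pow_eq_zero_iff hq, sub_eq_zero, sq_eq_one_iff] at hz
    rcases hz with rfl | rfl
    · exact ⟨1, by norm_num, by simp⟩
    · exact ⟨-1, by norm_num, by simp⟩
  | succ k ih =>
    set P : ℂ[X] := (rodrigues q k).map (algebraMap ℝ ℂ) with hP
    have hroot : P.rootSet ℂ ⊆ Complex.ofRealCLM '' Set.Icc (-1 : ℝ) 1 := by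
      intro w hw
      refine ih (by omega) ?_
      have := (mem_rootSet.1 hw).2
      simpa [hP, aeval_def, eval_map] using this
    have hdeg : 0 < P.degree := by
      rw [hP, degree_map]
      apply natDegree_pos_iff_degree_pos.1
      have := le_natDegree_of_ne_zero
        (coeff_rodrigues_pos (q := q) (k := k) (m := 2 * q - k) (by omega)).ne'
      omega
    have hconv : Convex ℝ (Complex.ofRealCLM '' Set.Icc (-1 : ℝ) 1) :=
      (convex_Icc _ _).linear_image Complex.ofRealCLM.toLinearMap
    refine convexHull_min hroot hconv (rootSet_derivative_subset_convexHull_rootSet hdeg ?_)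
    rw [mem_rootSet]
    have hd : derivative P = (rodrigues q (k + 1)).map (algebraMap ℝ ℂ) := by
      rw [hP, derivative_map, derivative_rodrigues]
    rw [hd]
    refine ⟨?_, by simpa [aeval_def, eval_map] using hz⟩
    rw [Ne, Polynomial.map_eq_zero]
    exact rodrigues_ne_zero (by omega)

theorem glNodes_subset_Icc {q : ℕ} (hq : 1 ≤ q) {a : ℝ} (ha : a ∈ glNodes q) :
    a ∈ Set.Icc (-1 : ℝ) 1 := by
  rw [glNodes_eq hq, Multiset.mem_toFinset, mem_roots (rodrigues_ne_zero (by omega))] at ha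
  obtain ⟨b, hb, hab⟩ := rodrigues_aeval_complex_eq_zero (q := q) (k := q - 1) (by omega)
    (z := (a : ℂ)) (by
      have := aeval_algebraMap_apply ℂ a (rodrigues q (q - 1))
      rw [Complex.coe_algebraMap] at this
      rw [this, coe_aeval_eq_eval, ha.eq_zero, Complex.ofReal_zero])
  have : b = a := by simpa using hab
  exact this ▸ hb

/-! ## The one-dimensional quadrature inequality -/

/-- Integration by parts `k` times; the boundary terms vanish because derivatives of order below `q`
are zero at `±1`. -/
theorem integral_rodrigues_mul {q k : ℕ} (hk : k ≤ q) (g : ℝ[X]) :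
    ∫ t in (-1 : ℝ)..1, (rodrigues q k).eval t * g.eval t =
      (-1) ^ k * ∫ t in (-1 : ℝ)..1, ((X ^ 2 - 1 : ℝ[X]) ^ q).eval t
        * (derivative^[k] g).eval t := by
  induction k generalizing g with
  | zero => simp [rodrigues]
  | succ k ih =>
    have := intervalIntegral.integral_mul_deriv_eq_deriv_mul (a := -1) (b := 1)
      (u := fun t => g.eval t) (v := fun t => (rodrigues q k).eval t)
      (u' := fun t => (derivative g).eval t) (v' := fun t => (rodrigues q (k + 1)).eval t)
      (fun x _ => g.hasDerivAt x)
      (fun x _ => by rw [← derivative_rodrigues]; exact (rodrigues q k).hasDerivAt x)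
      ((derivative g).continuous.intervalIntegrable _ _)
      ((rodrigues q (k + 1)).continuous.intervalIntegrable _ _)
    rw [eval_rodrigues_eq_zero (by omega : k < q) (by norm_num : (1 : ℝ) ^ 2 = 1),
      eval_rodrigues_eq_zero (by omega : k < q) (by norm_num : (-1 : ℝ) ^ 2 = 1)] at this
    simp_rw [mul_comm ((rodrigues q (k + 1)).eval _)]
    rw [this]
    simp_rw [mul_comm ((derivative g).eval _)]
    rw [ih (by omega) (derivative g), Function.iterate_succ_apply]
    ring

theorem glLagrange_eval {q : ℕ} (a b : glNodes q) :
    (glLagrange q a).eval (b : ℝ) = if a = b then 1 else 0 := by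
  classical
  split_ifs with h
  · subst h
    have := Lagrange.eval_basis_self (s := glNodes q) (v := (id : ℝ → ℝ))
      Function.injective_id.injOn a.2
    simpa [glLagrange] using this
  · have := Lagrange.eval_basis_of_ne (s := glNodes q) (v := (id : ℝ → ℝ)) (i := (a : ℝ))
      (j := (b : ℝ)) (fun h' => h (Subtype.ext h')) b.2
    simpa [glLagrange] using this

/-- A polynomial of degree less than the number of nodes equals its own Lagrange interpolant. -/
theorem sum_glWeight_mul_eval {q : ℕ} {r : ℝ[X]} (hr : r.degree < (glNodes q).card) :
    ∑ a, glWeight q a * r.eval (a : ℝ) = ∫ t in (-1 : ℝ)..1, r.eval t := by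
  have h : r = ∑ a : glNodes q, C (r.eval (a : ℝ)) * glLagrange q a := by
    have := Lagrange.eq_interpolate (s := glNodes q) (v := (id : ℝ → ℝ))
      Function.injective_id.injOn hr
    rw [Lagrange.interpolate_apply, ← Finset.sum_coe_sort] at this
    exact this
  conv_rhs => rw [h]
  simp only [eval_finsetSum, eval_mul, eval_C]
  rw [intervalIntegral.integral_finsetSum
    (fun a _ => ((glLagrange q a).continuous.const_mul _).intervalIntegrable _ _)]
  simp only [intervalIntegral.integral_const_mul, glWeight]
  exact Finset.sum_congr rfl fun a _ => mul_comm _ _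

theorem integral_sq_le_sum_glWeight {q : ℕ} (hq : 1 ≤ q) {p : ℝ[X]} (hp : p.natDegree ≤ q) :
    ∫ t in (-1 : ℝ)..1, p.eval t ^ 2 ≤ ∑ a, glWeight q a * p.eval (a : ℝ) ^ 2 := by
  set W := Lagrange.nodal (glNodes q) (id : ℝ → ℝ) with hWdef
  have hW : W.Monic := Lagrange.nodal_monic
  have hWdeg : W.natDegree = q + 1 := by rw [hWdef, Lagrange.natDegree_nodal, card_glNodes hq]
  set g := p ^ 2 /ₘ W with hg
  set r := p ^ 2 %ₘ W with hr
  have hpdeg : (p ^ 2).natDegree ≤ 2 * q := natDegree_pow_le.trans (by omega)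
  have hgdeg : g.natDegree ≤ q - 1 := by
    rw [hg, natDegree_divByMonic _ hW, hWdeg]
    omega
  have hrdeg : r.degree < (glNodes q).card := by
    have := degree_modByMonic_lt (p ^ 2) hW
    rwa [hWdef, Lagrange.degree_nodal] at this
  have hdecomp : r + W * g = p ^ 2 := modByMonic_add_div _ _
  -- Compare coefficients of `X^(2q)` in `p² = r + W g`: `r` has degree at most `q < 2q`, and `W` is
  -- monic, so this coefficient of `g` is the square of that of `X^q` in `p`.
  have hgcoeff : 0 ≤ g.coeff (q - 1) := by
    have h1 : (p ^ 2).coeff (q + q) = p.coeff q ^ 2 := by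
      rw [sq, coeff_mul_add_eq_of_natDegree_le hp hp, sq]
    have h2 : r.coeff (q + q) = 0 := coeff_eq_zero_of_degree_lt (hrdeg.trans_le (by
      rw [card_glNodes hq]; exact_mod_cast (by omega : q + 1 ≤ q + q)))
    have h3 : (W * g).coeff (q + q) = g.coeff (q - 1) := by
      rw [show q + q = (q + 1) + (q - 1) by omega,
        coeff_mul_add_eq_of_natDegree_le hWdeg.le hgdeg, ← hWdeg]
      change W.leadingCoeff * _ = _
      rw [hW.leadingCoeff, one_mul]
    rw [← hdecomp, coeff_add, h2, h3, zero_add] at h1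
    rw [h1]
    positivity
  have hnode : ∀ a : glNodes q, p.eval (a : ℝ) ^ 2 = r.eval (a : ℝ) := by
    intro a
    have h0 : W.eval (a : ℝ) = 0 := Lagrange.eval_nodal_at_node (v := (id : ℝ → ℝ)) a.2
    rw [← eval_pow, ← hdecomp, eval_add, eval_mul, h0, zero_mul, add_zero]
  simp_rw [hnode]
  rw [sum_glWeight_mul_eval hrdeg]
  have hint : ∫ t in (-1 : ℝ)..1, p.eval t ^ 2 =
      (∫ t in (-1 : ℝ)..1, r.eval t) + ∫ t in (-1 : ℝ)..1, W.eval t * g.eval t := by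
    rw [← intervalIntegral.integral_add (r.continuous.intervalIntegrable _ _)
      ((show Continuous fun t => W.eval t * g.eval t by fun_prop).intervalIntegrable _ _)]
    congr 1 with t
    rw [← eval_pow, ← hdecomp, eval_add, eval_mul]
  rw [hint]
  obtain ⟨c, hc, hcW⟩ := rodrigues_eq_mul_nodal hq
  have key := integral_rodrigues_mul (q := q) (k := q - 1) (by omega) g
  -- As `g` has degree at most `q - 1`, only a constant of the sign of its top coefficient remains.
  have hgd : derivative^[q - 1] g = C (((q - 1).factorial : ℝ) * g.coeff (q - 1)) := by
    have hd : (derivative^[q - 1] g).natDegree ≤ 0 :=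
      (natDegree_iterate_derivative _ _).trans (by omega)
    rw [eq_C_of_natDegree_le_zero hd, coeff_iterate_derivative, zero_add,
      Nat.descFactorial_self, nsmul_eq_mul]
  rw [hcW, hgd] at key
  simp only [eval_mul, eval_C, eval_pow, eval_sub, eval_X, eval_one, mul_assoc,
    intervalIntegral.integral_const_mul] at key
  have hsign : (-1 : ℝ) ^ (q - 1) * ∫ t in (-1 : ℝ)..1, (t ^ 2 - 1) ^ q *
      (((q - 1).factorial : ℝ) * g.coeff (q - 1)) ≤ 0 := by
    rw [← intervalIntegral.integral_const_mul, ← neg_nonneg, ← intervalIntegral.integral_neg]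
    refine intervalIntegral.integral_nonneg (by norm_num) fun t ht => ?_
    have ht2 : 0 ≤ 1 - t ^ 2 := by nlinarith [ht.1, ht.2]
    have hs : -((-1 : ℝ) ^ (q - 1) * ((t ^ 2 - 1) ^ q *
        (((q - 1).factorial : ℝ) * g.coeff (q - 1)))) =
        (1 - t ^ 2) ^ q * (((q - 1).factorial : ℝ) * g.coeff (q - 1)) := by
      obtain ⟨n, rfl⟩ : ∃ n, q = n + 1 := ⟨q - 1, by omega⟩
      rw [← neg_sub 1 (t ^ 2), neg_pow (1 - t ^ 2) (n + 1), Nat.add_sub_cancel, pow_succ (-1 : ℝ) n]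
      have h1 : ((-1 : ℝ) ^ n) * (-1) ^ n = 1 := by rw [← mul_pow]; norm_num
      linear_combination (1 - t ^ 2) ^ (n + 1) * (n.factorial * g.coeff n) * h1
    rw [hs]
    positivity
  rw [← key] at hsign
  linarith [nonpos_of_mul_nonpos_right hsign hc]

end

end SpectralFEM

namespace SpectralFEM

section

open Polynomial MeasureTheory Matrix

/-! ## Reference element matrices -/

theorem continuous_refBasis {d : ℕ} {q : Fin d → ℕ} (k : LocalIndex q) :
    Continuous (refBasis k) := by
  unfold refBasis
  fun_prop

/-- The one-dimensional mass matrix of the Lagrange basis. -/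
def massMatrixOne (q : ℕ) : Matrix (glNodes q) (glNodes q) ℝ :=
  of fun a b => ∫ t in (-1 : ℝ)..1, (glLagrange q a).eval t * (glLagrange q b).eval t

theorem massMatrixOne_quadratic (q : ℕ) (y : glNodes q → ℝ) :
    y ⬝ᵥ (massMatrixOne q *ᵥ y) =
      ∫ t in (-1 : ℝ)..1, (∑ a, C (y a) * glLagrange q a).eval t ^ 2 := by
  have : ∀ t : ℝ, (∑ a, C (y a) * glLagrange q a).eval t ^ 2 =
      ∑ a, ∑ b, y a * (y b * ((glLagrange q a).eval t * (glLagrange q b).eval t)) := by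
    intro t
    simp only [eval_finsetSum, eval_mul, eval_C, sq, Finset.sum_mul_sum]
    exact Finset.sum_congr rfl fun a _ => Finset.sum_congr rfl fun b _ => by ring
  simp_rw [this]
  rw [intervalIntegral.integral_finsetSum
    (fun a _ => Continuous.intervalIntegrable (by fun_prop) _ _)]
  simp only [dotProduct, mulVec, massMatrixOne, of_apply, Finset.mul_sum]
  refine Finset.sum_congr rfl fun a _ => ?_
  rw [intervalIntegral.integral_finsetSum
    (fun b _ => Continuous.intervalIntegrable (by fun_prop) _ _)]
  refine Finset.sum_congr rfl fun b _ => ?_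
  rw [intervalIntegral.integral_const_mul, intervalIntegral.integral_const_mul]
  ring

theorem massMatrixOne_isHermitian (q : ℕ) : (massMatrixOne q).IsHermitian := by
  ext a b
  simp [massMatrixOne, mul_comm]

theorem massMatrixOne_posSemidef (q : ℕ) : (massMatrixOne q).PosSemidef := by
  refine .of_dotProduct_mulVec_nonneg (massMatrixOne_isHermitian q) fun y => ?_
  rw [star_trivial, massMatrixOne_quadratic]
  exact intervalIntegral.integral_nonneg (by norm_num) fun t _ => sq_nonneg _

/-- The quadrature inequality for `p = ∑ y_a ℓ_a`, whose nodal values are the `y_a`. -/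
theorem diagonal_glWeight_sub_posSemidef {q : ℕ} (hq : 1 ≤ q) :
    (diagonal (glWeight q) - massMatrixOne q).PosSemidef := by
  refine .of_dotProduct_mulVec_nonneg
    ((isHermitian_diagonal _).sub (massMatrixOne_isHermitian q)) fun y => ?_
  rw [star_trivial, sub_mulVec, dotProduct_sub, massMatrixOne_quadratic, sub_nonneg]
  have hdeg : (∑ a, C (y a) * glLagrange q a).natDegree ≤ q := by
    refine natDegree_sum_le_of_forall_le _ _ fun a _ => (natDegree_C_mul_le _ _).trans ?_
    rw [glLagrange, Lagrange.natDegree_basis Function.injective_id.injOn a.2, card_glNodes hq]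
    omega
  refine (integral_sq_le_sum_glWeight hq hdeg).trans_eq ?_
  simp only [dotProduct, mulVec_diagonal]
  refine Finset.sum_congr rfl fun a _ => ?_
  have : (∑ b, C (y b) * glLagrange q b).eval (a : ℝ) = y a := by
    simp [eval_finsetSum, glLagrange_eval]
  rw [this]
  ring

/-- Tensor products respect the Loewner order on positive semidefinite matrices. -/
theorem posSemidef_prod_sub_prod {ι : Type*} [Fintype ι] {κ : ι → Type*} [∀ j, Fintype (κ j)]
    {A B : ∀ j, Matrix (κ j) (κ j) ℝ} (hB : ∀ j, (B j).PosSemidef)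
    (hAB : ∀ j, (A j - B j).PosSemidef) (s : Finset ι) :
    (of fun k l : ∀ j, κ j => ∏ j ∈ s, B j (k j) (l j)).PosSemidef ∧
    ((of fun k l : ∀ j, κ j => ∏ j ∈ s, A j (k j) (l j)) -
      of fun k l : ∀ j, κ j => ∏ j ∈ s, B j (k j) (l j)).PosSemidef := by
  classical
  induction s using Finset.induction_on with
  | empty =>
    have h1 : (of fun _ _ : ∀ j, κ j => (1 : ℝ)) = vecMulVec (fun _ => 1) (star fun _ => 1) := by
      ext; simp [vecMulVec]
    simp only [Finset.prod_empty, sub_self]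
    exact ⟨h1 ▸ posSemidef_vecMulVec_self_star _, .zero⟩
  | insert j s hj ih =>
    -- Pulled back to multi-indices, the factors stay positive semidefinite and the tensor product
    -- becomes a Hadamard product.
    have hBj := (hB j).submatrix fun k : ∀ j, κ j => k j
    have hABj := (hAB j).submatrix fun k : ∀ j, κ j => k j
    have hA : (of fun k l : ∀ j, κ j => ∏ j ∈ s, A j (k j) (l j)).PosSemidef := by
      have := ih.2.add ih.1
      rwa [sub_add_cancel] at this
    constructor
    · have hprod : (of fun k l : ∀ j, κ j => ∏ j ∈ insert j s, B j (k j) (l j)) =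
          ((B j).submatrix (fun k => k j) fun k => k j) ⊙
            of fun k l : ∀ j, κ j => ∏ j ∈ s, B j (k j) (l j) := by
        ext k l
        simp [Finset.prod_insert hj]
      rw [hprod]
      exact hBj.hadamard ih.1
    -- The splitting `A ⊙ A' - B ⊙ B' = (A - B) ⊙ A' + B ⊙ (A' - B')` has only Hadamard products of
    -- positive semidefinite matrices.
    · have hprod : ((of fun k l : ∀ j, κ j => ∏ j ∈ insert j s, A j (k j) (l j)) -
            of fun k l : ∀ j, κ j => ∏ j ∈ insert j s, B j (k j) (l j)) =
          (((A j - B j).submatrix (fun k => k j) fun k => k j) ⊙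
            of fun k l : ∀ j, κ j => ∏ j ∈ s, A j (k j) (l j)) +
          ((B j).submatrix (fun k => k j) fun k => k j) ⊙
            ((of fun k l : ∀ j, κ j => ∏ j ∈ s, A j (k j) (l j)) -
              of fun k l : ∀ j, κ j => ∏ j ∈ s, B j (k j) (l j)) := by
        ext k l
        simp [Finset.prod_insert hj]
        ring
      rw [hprod]
      exact (hABj.hadamard hA).add (hBj.hadamard ih.2)

section Reference

variable {d : ℕ} {q : Fin d → ℕ}

/-- The mass matrix of the reference element. -/
def refMass (q : Fin d → ℕ) : Matrix (LocalIndex q) (LocalIndex q) ℝ :=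
  of fun k l => ∫ x in refCube d, refBasis k x * refBasis l x

theorem refCube_eq_preimage :
    refCube d = WithLp.ofLp ⁻¹' (Set.univ.pi fun _ : Fin d => Set.Icc (-1 : ℝ) 1) := by
  ext x
  simp [refCube, -Set.pi_univ_Icc]

theorem refMass_apply (k l : LocalIndex q) :
    refMass q k l = ∏ j, massMatrixOne (q j) (k j) (l j) := by
  have h := (PiLp.volume_preserving_ofLp (Fin d)).setIntegral_preimage_emb
    (MeasurableEquiv.toLp 2 (Fin d → ℝ)).symm.measurableEmbedding
    (fun y => ∏ j, ((glLagrange (q j) (k j)).eval (y j) * (glLagrange (q j) (l j)).eval (y j)))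
    (Set.univ.pi fun _ : Fin d => Set.Icc (-1 : ℝ) 1)
  rw [← refCube_eq_preimage] at h
  rw [refMass, of_apply]
  simp only [refBasis, ← Finset.prod_mul_distrib]
  rw [h, volume_pi, Measure.restrict_pi_pi]
  rw [integral_fintype_prod_eq_prod (fun j t =>
    (glLagrange (q j) (k j)).eval t * (glLagrange (q j) (l j)).eval t)]
  refine Finset.prod_congr rfl fun j _ => ?_
  rw [massMatrixOne, of_apply, intervalIntegral.integral_of_le (by norm_num),
    integral_Icc_eq_integral_Ioc]

theorem convex_refCube : Convex ℝ (refCube d) := by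
  intro x hx y hy a b ha hb hab j
  exact convex_Icc (-1 : ℝ) 1 (hx j) (hy j) ha hb hab

theorem isCompact_refCube : IsCompact (refCube d) := by
  rw [refCube_eq_preimage]
  exact (PiLp.homeomorph 2 fun _ : Fin d => ℝ).isCompact_preimage.2
    (isCompact_univ_pi fun _ => isCompact_Icc)

theorem interior_refCube_nonempty : (interior (refCube d)).Nonempty := by
  refine ⟨0, mem_interior.2 ⟨{x | ∀ j, x j ∈ Set.Ioo (-1 : ℝ) 1}, ?_, ?_, ?_⟩⟩
  · exact fun x hx j => Set.Ioo_subset_Icc_self (hx j)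
  · simp only [Set.ofPred_forall]
    exact isOpen_iInter_of_finite fun j => isOpen_Ioo.preimage (by fun_prop)
  · intro j
    simp

theorem refBasis_refNode (k l : LocalIndex q) :
    refBasis k (refNode l) = if k = l then 1 else 0 := by
  simp only [refBasis, refNode, glLagrange_eval]
  rw [Finset.prod_ite_zero]
  simp [funext_iff]

theorem refNode_mem_refCube (hq : ∀ j, 1 ≤ q j) (k : LocalIndex q) : refNode k ∈ refCube d :=
  fun j => glNodes_subset_Icc (hq j) (k j).2

theorem diagonal_refWeight_sub_posSemidef (hq : ∀ j, 1 ≤ q j) :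
    (diagonal refWeight - refMass q).PosSemidef := by
  have := (posSemidef_prod_sub_prod (fun j => massMatrixOne_posSemidef (q j))
    (fun j => diagonal_glWeight_sub_posSemidef (hq j)) Finset.univ).2
  convert this using 2
  · ext k l
    simp only [diagonal_apply, of_apply, refWeight]
    rw [Finset.prod_ite_zero]
    simp [funext_iff]
  · ext k l
    rw [refMass_apply, of_apply]

theorem refMass_bilinear (y z : LocalIndex q → ℝ) :
    y ⬝ᵥ (refMass q *ᵥ z) =
      ∫ x in refCube d, (∑ k, y k * refBasis k x) * ∑ k, z k * refBasis k x := by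
  have : ∀ x, (∑ k, y k * refBasis k x) * ∑ k, z k * refBasis k x =
      ∑ k, ∑ l, y k * (z l * (refBasis k x * refBasis l x)) := by
    intro x
    simp only [Finset.sum_mul_sum]
    exact Finset.sum_congr rfl fun a _ => Finset.sum_congr rfl fun b _ => by ring
  have hint : ∀ k l : LocalIndex q, IntegrableOn
      (fun x => y k * (z l * (refBasis k x * refBasis l x))) (refCube d) := fun k l =>
    (continuous_const.mul (continuous_const.mul
      ((continuous_refBasis k).mul (continuous_refBasis l)))).continuousOn.integrableOn_compact
        isCompact_refCube
  simp_rw [this]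
  rw [integral_finsetSum _ fun k _ => integrable_finsetSum _ fun l _ => hint k l]
  simp only [dotProduct, mulVec, refMass, of_apply, Finset.mul_sum]
  refine Finset.sum_congr rfl fun a _ => ?_
  rw [integral_finsetSum _ fun l _ => hint a l]
  refine Finset.sum_congr rfl fun b _ => ?_
  rw [integral_const_mul, integral_const_mul]
  ring

/-- If the quadratic form vanishes, the interpolant is zero almost everywhere on the cube, hence
everywhere there by continuity, since the cube lies in the closure of its interior. The nodes belong
to the cube, and the values there are the coefficients. -/
theorem refMass_posDef (hq : ∀ j, 1 ≤ q j) : (refMass q).PosDef := by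
  refine .of_dotProduct_mulVec_pos ?_ fun y hy => ?_
  · ext k l
    simp [refMass, mul_comm]
  rw [star_trivial, refMass_bilinear]
  simp_rw [← sq]
  refine lt_of_le_of_ne (integral_nonneg fun x => sq_nonneg _) fun h0 => hy ?_
  have hcont : Continuous fun x => ∑ k, y k * refBasis k x :=
    continuous_finsetSum _ fun k _ => continuous_const.mul (continuous_refBasis k)
  have hae := (setIntegral_eq_zero_iff_of_nonneg_ae (Filter.Eventually.of_forall fun x =>
    sq_nonneg _) ((hcont.pow 2).continuousOn.integrableOn_compact isCompact_refCube)).1 h0.symm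
  have heq := Measure.eqOn_of_ae_eq hae (hcont.pow 2).continuousOn continuousOn_const
    (by
      rw [convex_refCube.closure_interior_eq_closure_of_nonempty_interior
        interior_refCube_nonempty]
      exact subset_closure)
  funext k
  have := heq (refNode_mem_refCube hq k)
  simpa [refBasis_refNode] using this

end Reference

end

end SpectralFEM

namespace SpectralFEM

section

open MeasureTheory Matrix

/-! ## Assembly of the global matrices -/

theorem hasFDerivAt_affineEquiv {V : Type*} [NormedAddCommGroup V] [NormedSpace ℝ V]
    [FiniteDimensional ℝ V] (F : V ≃ᵃ[ℝ] V) (x : V) :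
    HasFDerivAt F (LinearMap.toContinuousLinearMap (F.linear : V →ₗ[ℝ] V)) x := by
  have h : (F : V → V) =
      fun y => LinearMap.toContinuousLinearMap (F.linear : V →ₗ[ℝ] V) y + F 0 :=
    AffineMap.decomp (F : V →ᵃ[ℝ] V)
  rw [h]
  exact (ContinuousLinearMap.hasFDerivAt _).add_const _

theorem contDiff_affineEquiv {V : Type*} [NormedAddCommGroup V] [NormedSpace ℝ V]
    [FiniteDimensional ℝ V] (F : V ≃ᵃ[ℝ] V) : ContDiff ℝ 1 F := by
  have h : (F : V → V) =
      fun y => LinearMap.toContinuousLinearMap (F.linear : V →ₗ[ℝ] V) y + F 0 :=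
    AffineMap.decomp (F : V →ᵃ[ℝ] V)
  rw [h]
  exact (ContinuousLinearMap.contDiff _).add contDiff_const

variable {d : ℕ} {q : Fin d → ℕ}

theorem contDiff_refBasis (k : LocalIndex q) : ContDiff ℝ 1 (refBasis k) := by
  unfold refBasis
  refine contDiff_prod fun j _ => ?_
  exact (show ContDiff ℝ 1 fun t : ℝ => (glLagrange (q j) (k j)).eval t by
    simpa using (glLagrange (q j) (k j)).contDiff_aeval (𝕜 := ℝ) 1).comp (contDiff_euclidean.1 contDiff_id j)

theorem contDiff_elementBasis (F : EuclideanSpace ℝ (Fin d) ≃ᵃ[ℝ] EuclideanSpace ℝ (Fin d))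
    (z : EuclideanSpace ℝ (Fin d)) : ContDiff ℝ 1 (elementBasis q F z) := by
  unfold elementBasis
  refine ContDiff.sum fun k _ => ?_
  split_ifs
  · exact (contDiff_refBasis k).comp (contDiff_affineEquiv F.symm)
  · exact contDiff_const

theorem continuous_gradient_elementBasis
    (F : EuclideanSpace ℝ (Fin d) ≃ᵃ[ℝ] EuclideanSpace ℝ (Fin d))
    (z : EuclideanSpace ℝ (Fin d)) : Continuous (gradient (elementBasis q F z)) :=
  (LinearIsometryEquiv.continuous _).comp ((contDiff_elementBasis F z).continuous_fderiv one_ne_zero)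

namespace Mesh

variable {E : Type*} (T : Mesh d q E)

theorem convex_element (e : E) : Convex ℝ (T.element e) :=
  convex_refCube.affine_image (T.map e : EuclideanSpace ℝ (Fin d) →ᵃ[ℝ] EuclideanSpace ℝ (Fin d))

theorem isCompact_element (e : E) : IsCompact (T.element e) :=
  isCompact_refCube.image (contDiff_affineEquiv (T.map e)).continuous

theorem absJac_pos (e : E) : 0 < T.absJac e :=
  abs_pos.2 (LinearEquiv.isUnit_det' (T.map e).linear).ne_zero

/-- The frontier of a convex set is null. So overlaps of elements, and the values of the density and
gradients on element boundaries, do not affect the integrals. -/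
theorem interior_ae_eq_element (e : E) :
    (interior (T.element e) : Set _) =ᵐ[volume] T.element e :=
  interior_ae_eq_of_null_frontier ((T.convex_element e).addHaar_frontier volume)

theorem ae_mem_interior (e : E) :
    ∀ᵐ x ∂volume.restrict (T.element e), x ∈ interior (T.element e) := by
  rw [← Measure.restrict_congr_set (T.interior_ae_eq_element e)]
  exact ae_restrict_mem isOpen_interior.measurableSet

theorem setIntegral_element (e : E) (f : EuclideanSpace ℝ (Fin d) → ℝ) :
    ∫ x in T.element e, f x = T.absJac e * ∫ y in refCube d, f (T.map e y) := by
  have := integral_image_eq_integral_abs_det_fderiv_smul volume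
    (isCompact_refCube (d := d)).measurableSet
    (fun x _ => (hasFDerivAt_affineEquiv (T.map e) x).hasFDerivWithinAt)
    (T.map e).injective.injOn f
  simp only [smul_eq_mul, integral_const_mul] at this
  rw [ContinuousLinearMap.det, LinearMap.coe_toContinuousLinearMap] at this
  exact this

theorem setIntegral_domain [Fintype E] {f : EuclideanSpace ℝ (Fin d) → ℝ}
    (hf : ∀ e, IntegrableOn f (T.element e)) :
    ∫ x in T.domain, f x = ∑ e, ∫ x in T.element e, f x := by
  rw [domain, integral_iUnion_ae (fun e => (T.isCompact_element e).measurableSet.nullMeasurableSet)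
    _ (integrableOn_finite_iUnion.2 hf), tsum_fintype]
  intro e e' h
  exact (T.disjoint_interior h).aedisjoint.congr (T.interior_ae_eq_element e).symm
    (T.interior_ae_eq_element e').symm

/-- Restricted to the interior, since the glued function may have kinks across element faces. -/
theorem gradient_basis_eq {e : E} {x : EuclideanSpace ℝ (Fin d)}
    (hx : x ∈ interior (T.element e)) (z : EuclideanSpace ℝ (Fin d)) :
    gradient (T.basis z) x = gradient (elementBasis q (T.map e) z) x := by
  have : T.basis z =ᶠ[nhds x] elementBasis q (T.map e) z := by
    filter_upwards [mem_interior_iff_mem_nhds.1 hx] with y hy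
    exact T.basis_eq_elementBasis z hy
  rw [gradient, gradient, this.fderiv_eq]

variable [Fintype E] (Γ : Set (EuclideanSpace ℝ (Fin d)))

open Classical in
/-- The incidence matrix between the local nodes of the element `e` and the global free nodes. -/
def incidence (e : E) : Matrix (LocalIndex q) (T.freeNodes Γ) ℝ :=
  of fun k i => if T.map e (refNode k) = i then 1 else 0

theorem elementBasis_map (e : E) (i : T.freeNodes Γ) (y : EuclideanSpace ℝ (Fin d)) :
    elementBasis q (T.map e) i (T.map e y) = ∑ k, T.incidence Γ e k i * refBasis k y := by
  simp [elementBasis, incidence]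

theorem basis_map_refNode (hq : ∀ j, 1 ≤ q j) (e : E) (i : T.freeNodes Γ) (k : LocalIndex q) :
    T.basis i (T.map e (refNode k)) = T.incidence Γ e k i := by
  rw [T.basis_eq_elementBasis _ (Set.mem_image_of_mem _ (refNode_mem_refCube hq k)),
    elementBasis_map]
  simp [refBasis_refNode]

variable {ρ : EuclideanSpace ℝ (Fin d) → ℝ} {ρe : E → ℝ}

theorem massMatrix_eq_sum (hρ : ∀ e, ∀ x ∈ interior (T.element e), ρ x = ρe e) :
    T.massMatrix Γ ρ =
      ∑ e, (ρe e * T.absJac e) • ((T.incidence Γ e)ᵀ * refMass q * T.incidence Γ e) := by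
  ext i j
  have hae : ∀ e, (fun x => ρ x * T.basis i x * T.basis j x)
      =ᵐ[volume.restrict (T.element e)] fun x => ρe e *
        (elementBasis q (T.map e) i x * elementBasis q (T.map e) j x) := by
    intro e
    filter_upwards [T.ae_mem_interior e] with x hx
    rw [hρ e x hx, T.basis_eq_elementBasis _ (interior_subset hx),
      T.basis_eq_elementBasis _ (interior_subset hx), mul_assoc]
  have hint : ∀ e, IntegrableOn (fun x => ρ x * T.basis i x * T.basis j x) (T.element e) := by
    intro e
    refine IntegrableOn.congr_fun_ae ?_ (hae e).symm
    exact (continuous_const.mul ((contDiff_elementBasis _ _).continuous.mul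
      (contDiff_elementBasis _ _).continuous)).continuousOn.integrableOn_compact
        (T.isCompact_element e)
  rw [massMatrix, of_apply, massForm, T.setIntegral_domain hint, Matrix.sum_apply]
  refine Finset.sum_congr rfl fun e _ => ?_
  rw [integral_congr_ae (hae e), integral_const_mul, T.setIntegral_element e, Matrix.smul_apply,
    smul_eq_mul, mul_assoc]
  congr 2
  simp_rw [elementBasis_map]
  rw [Matrix.mul_assoc]
  exact (refMass_bilinear (fun k => T.incidence Γ e k i) fun k => T.incidence Γ e k j).symm

theorem lumpedMatrix_eq_sum (hq : ∀ j, 1 ≤ q j) :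
    T.lumpedMatrix Γ ρe = ∑ e, (ρe e * T.absJac e) •
      ((T.incidence Γ e)ᵀ * diagonal (refWeight (q := q)) * T.incidence Γ e) := by
  ext i j
  rw [lumpedMatrix, of_apply, lumpedForm, Matrix.sum_apply]
  refine Finset.sum_congr rfl fun e _ => ?_
  rw [Matrix.smul_apply, smul_eq_mul, mul_apply, Finset.mul_sum]
  refine Finset.sum_congr rfl fun k _ => ?_
  rw [mul_diagonal, transpose_apply, T.basis_map_refNode Γ hq, T.basis_map_refNode Γ hq]
  ring

theorem lumpedMatrix_sub_massMatrix_posSemidef (hq : ∀ j, 1 ≤ q j)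
    (hρ : ∀ e, ∀ x ∈ interior (T.element e), ρ x = ρe e) (hρpos : ∀ e, 0 < ρe e) :
    (T.lumpedMatrix Γ ρe - T.massMatrix Γ ρ).PosSemidef := by
  rw [T.massMatrix_eq_sum Γ hρ, T.lumpedMatrix_eq_sum Γ hq, ← Finset.sum_sub_distrib]
  refine posSemidef_sum _ fun e _ => ?_
  rw [← smul_sub, ← Matrix.sub_mul, ← Matrix.mul_sub, ← conjTranspose_eq_transpose_of_trivial]
  exact ((diagonal_refWeight_sub_posSemidef hq).conjTranspose_mul_mul_same _).smul
    (mul_pos (hρpos e) (T.absJac_pos e)).le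

/-- All element contributions are nonnegative. A nonzero coefficient sits at a node of some element,
whose local coefficient vector is then nonzero, so that contribution is positive. -/
theorem massMatrix_posDef (hq : ∀ j, 1 ≤ q j)
    (hρ : ∀ e, ∀ x ∈ interior (T.element e), ρ x = ρe e) (hρpos : ∀ e, 0 < ρe e) :
    (T.massMatrix Γ ρ).PosDef := by
  have hc : ∀ e, 0 < ρe e * T.absJac e := fun e => mul_pos (hρpos e) (T.absJac_pos e)
  refine .of_dotProduct_mulVec_pos ?_ fun x hx => ?_
  · ext i j
    simp [massMatrix, massForm, mul_right_comm]
  obtain ⟨i, hi⟩ := Function.ne_iff.1 hx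
  have hquad : star x ⬝ᵥ (T.massMatrix Γ ρ *ᵥ x) = ∑ e, (ρe e * T.absJac e) *
      ((T.incidence Γ e *ᵥ x) ⬝ᵥ (refMass q *ᵥ (T.incidence Γ e *ᵥ x))) := by
    rw [T.massMatrix_eq_sum Γ hρ, sum_mulVec, dotProduct_sum]
    refine Finset.sum_congr rfl fun e _ => ?_
    rw [smul_mulVec, dotProduct_smul, smul_eq_mul, ← mulVec_mulVec, ← mulVec_mulVec,
      dotProduct_mulVec, star_trivial, vecMul_transpose]
  rw [hquad]
  have hnode := i.2
  simp only [freeNodes, Finset.mem_filter, Finset.mem_image, Finset.mem_univ, true_and] at hnode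
  obtain ⟨⟨⟨e, k⟩, hk⟩, -⟩ := hnode
  refine Finset.sum_pos' (fun e _ => mul_nonneg (hc e).le ?_)
    ⟨e, Finset.mem_univ e, mul_pos (hc e) ?_⟩
  · have := (refMass_posDef hq).posSemidef.dotProduct_mulVec_nonneg (T.incidence Γ e *ᵥ x)
    rwa [star_trivial] at this
  · have := (refMass_posDef hq).dotProduct_mulVec_pos (x := T.incidence Γ e *ᵥ x) ?_
    · rwa [star_trivial] at this
    · intro h0
      apply hi
      have := congrFun h0 k
      simpa [mulVec, dotProduct, incidence, hk, Subtype.coe_inj] using this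

variable {κ : EuclideanSpace ℝ (Fin d) → ℝ}

theorem integrableOn_stiffness (hκint : IntegrableOn κ T.domain) (z w : EuclideanSpace ℝ (Fin d)) :
    IntegrableOn (fun x => κ x * inner ℝ (gradient (T.basis z) x) (gradient (T.basis w) x))
      T.domain := by
  refine integrableOn_finite_iUnion.2 fun e => ?_
  have h : IntegrableOn (fun x => κ x * inner ℝ (gradient (elementBasis q (T.map e) z) x)
      (gradient (elementBasis q (T.map e) w) x)) (T.element e) :=
    (hκint.mono_set (Set.subset_iUnion _ e)).mul_continuousOn
      ((continuous_gradient_elementBasis _ _).inner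
        (continuous_gradient_elementBasis _ _)).continuousOn (T.isCompact_element e)
  refine h.congr_fun_ae ?_
  filter_upwards [T.ae_mem_interior e] with x hx
  rw [T.gradient_basis_eq hx, T.gradient_basis_eq hx]

/-- The quadratic form is the integral of `κ |∑ y_i ∇φ_i|²`; summing the gradients themselves avoids
differentiating the global sum. -/
theorem stiffMatrix_posSemidef (hκ : ∀ x ∈ T.domain, 0 < κ x) (hκint : IntegrableOn κ T.domain) :
    (T.stiffMatrix Γ κ).PosSemidef := by
  refine .of_dotProduct_mulVec_nonneg ?_ fun y => ?_
  · ext i j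
    simp only [conjTranspose_apply, star_trivial, stiffMatrix, stiffForm, of_apply]
    simp_rw [real_inner_comm (gradient (T.basis i) _)]
  have hmeas : MeasurableSet T.domain :=
    MeasurableSet.iUnion fun e => (T.isCompact_element e).measurableSet
  have hquad : star y ⬝ᵥ (T.stiffMatrix Γ κ *ᵥ y) = ∫ x in T.domain, κ x *
      inner ℝ (∑ i, y i • gradient (T.basis i) x) (∑ i, y i • gradient (T.basis i) x) := by
    have hexp : ∀ x, κ x * inner ℝ (∑ i, y i • gradient (T.basis i) x)
        (∑ i, y i • gradient (T.basis i) x) = ∑ i, ∑ j, y i * (y j *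
          (κ x * inner ℝ (gradient (T.basis i) x) (gradient (T.basis j) x))) := by
      intro x
      simp only [sum_inner, inner_sum, real_inner_smul_left, real_inner_smul_right, Finset.mul_sum]
      exact Finset.sum_congr rfl fun i _ => Finset.sum_congr rfl fun j _ => by
        rw [real_inner_comm]; ring
    have hint : ∀ i j : T.freeNodes Γ, IntegrableOn (fun x => y i * (y j *
        (κ x * inner ℝ (gradient (T.basis i) x) (gradient (T.basis j) x)))) T.domain := fun i j =>
      ((T.integrableOn_stiffness hκint i j).const_mul _).const_mul _
    simp_rw [hexp]
    rw [integral_finsetSum _ fun i _ => integrable_finsetSum _ fun j _ => hint i j, star_trivial]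
    simp only [dotProduct, mulVec, stiffMatrix, stiffForm, of_apply, Finset.mul_sum]
    refine Finset.sum_congr rfl fun i _ => ?_
    rw [integral_finsetSum _ fun j _ => hint i j]
    refine Finset.sum_congr rfl fun j _ => ?_
    rw [integral_const_mul, integral_const_mul]
    ring
  rw [hquad]
  exact setIntegral_nonneg hmeas fun x hx => mul_nonneg (hκ x hx).le real_inner_self_nonneg

end Mesh

end

end SpectralFEM

namespace SpectralFEM

section

open Polynomial

/-! ## Comparison of generalized eigenvalues -/

section Comparison

open Matrix

variable {n : Type*} [Fintype n] [DecidableEq n]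

/-- A symmetric matrix and a positive definite matrix are simultaneously diagonalizable by
congruence. -/
theorem exists_simultaneous_diagonalization {A B : Matrix n n ℝ} (hA : A.IsHermitian)
    (hB : B.PosDef) :
    ∃ (S : Matrix n n ℝ) (D : n → ℝ), Sᵀ * B * S = 1 ∧ Sᵀ * A * S = diagonal D := by
  have orth : ∀ {C : Matrix n n ℝ} (hC : C.IsHermitian), ∃ U : Matrix n n ℝ,
      Uᵀ * U = 1 ∧ Uᵀ * C * U = diagonal hC.eigenvalues := by
    intro C hC
    have hU : (hC.eigenvectorUnitary : Matrix n n ℝ)ᵀ * hC.eigenvectorUnitary = 1 := by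
      have := Unitary.coe_star_mul_self hC.eigenvectorUnitary
      rwa [star_eq_conjTranspose, conjTranspose_eq_transpose_of_trivial] at this
    refine ⟨hC.eigenvectorUnitary, hU, ?_⟩
    have hs := hC.spectral_theorem
    rw [Unitary.conjStarAlgAut_apply, star_eq_conjTranspose,
      conjTranspose_eq_transpose_of_trivial] at hs
    generalize (hC.eigenvectorUnitary : Matrix n n ℝ) = U at hU hs ⊢
    rw [show Uᵀ * C * U = Uᵀ * (U * diagonal (RCLike.ofReal ∘ hC.eigenvalues) * Uᵀ) * U from
      congrArg (fun M => Uᵀ * M * U) hs, ← Matrix.mul_assoc, ← Matrix.mul_assoc, hU, Matrix.one_mul, Matrix.mul_assoc, hU,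
      Matrix.mul_one]
    rfl
  -- Normalize `B` to the identity by `U * R`, with `R` the inverse square roots of its eigenvalues;
  -- an orthogonal `V` then diagonalizes the transformed `A` and preserves the identity.
  obtain ⟨U, hU, hUB⟩ := orth hB.isHermitian
  set b := hB.isHermitian.eigenvalues with hb
  set R : Matrix n n ℝ := diagonal fun i => (√(b i))⁻¹ with hR
  have hRt : Rᵀ = R := diagonal_transpose _
  have hRB : (U * R)ᵀ * B * (U * R) = 1 := by
    have : (U * R)ᵀ * B * (U * R) = Rᵀ * (Uᵀ * B * U) * R := by
      simp only [transpose_mul, Matrix.mul_assoc]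
    rw [this, hUB, hRt, hR, diagonal_mul_diagonal, diagonal_mul_diagonal, ← diagonal_one]
    congr 1
    ext i
    have hpos : 0 < b i := hB.eigenvalues_pos i
    have hsq := Real.mul_self_sqrt hpos.le
    have : √(b i) ≠ 0 := (Real.sqrt_pos.2 hpos).ne'
    field_simp
    rw [sq, hsq]
  have hH : ((U * R)ᵀ * A * (U * R)).IsHermitian := by
    have := isHermitian_conjTranspose_mul_mul (U * R) hA
    rwa [conjTranspose_eq_transpose_of_trivial] at this
  obtain ⟨V, hV, hVH⟩ := orth hH
  refine ⟨U * R * V, hH.eigenvalues, ?_, ?_⟩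
  · have : (U * R * V)ᵀ * B * (U * R * V) = Vᵀ * ((U * R)ᵀ * B * (U * R)) * V := by
      simp only [transpose_mul, Matrix.mul_assoc]
    rw [this, hRB, Matrix.mul_one, hV]
  · rw [← hVH]
    simp only [transpose_mul, Matrix.mul_assoc]

theorem quadratic_congruence {A S : Matrix n n ℝ} {D : n → ℝ} (h : Sᵀ * A * S = diagonal D) (y : n → ℝ) :
    (S *ᵥ y) ⬝ᵥ (A *ᵥ (S *ᵥ y)) = ∑ i, D i * y i ^ 2 := by
  have : (S *ᵥ y) ⬝ᵥ (A *ᵥ (S *ᵥ y)) = y ⬝ᵥ ((Sᵀ * A * S) *ᵥ y) := by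
    rw [← mulVec_mulVec, ← mulVec_mulVec, dotProduct_mulVec y, vecMul_transpose]
  rw [this, h]
  simp only [dotProduct, mulVec_diagonal]
  exact Finset.sum_congr rfl fun i _ => by ring

/-- Congruence by `S` multiplies `det (A - t B)` by the nonzero constant `(det S)²`, so its roots
are those of `∏ (D i - t)`, with multiplicity. -/
theorem genEigList_eq_sort {A B S : Matrix n n ℝ} {D : n → ℝ} (hB : Sᵀ * B * S = 1)
    (hA : Sᵀ * A * S = diagonal D) :
    genEigList A B = (Finset.univ.val.map D).sort (· ≤ ·) := by
  have hdet : S.det ^ 2 * B.det = 1 := by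
    have := congrArg det hB
    rw [det_mul, det_mul, det_transpose, det_one] at this
    linarith
  have hS : S.det ^ 2 ≠ 0 := left_ne_zero_of_mul_eq_one hdet
  have hmat : (S.map C)ᵀ * (A.map C - (X : ℝ[X]) • B.map C) * S.map C =
      diagonal fun i => C (D i) - X := by
    have hA' := congrArg (fun M => M.map (C : ℝ →+* ℝ[X])) hA
    have hB' := congrArg (fun M => M.map (C : ℝ →+* ℝ[X])) hB
    simp only [Matrix.map_mul] at hA' hB'
    rw [← transpose_map, Matrix.mul_sub, Matrix.sub_mul, hA', Matrix.mul_smul, Matrix.smul_mul, hB']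
    ext i j
    by_cases hij : i = j
    · subst hij; simp
    · simp [hij]
  have h := congrArg det hmat
  rw [det_mul, det_mul, det_transpose, det_diagonal] at h
  have hSC : (S.map (C : ℝ →+* ℝ[X])).det = C S.det := by
    rw [RingHom.map_det]; rfl
  rw [hSC] at h
  have h2 : C (S.det ^ 2) * (A.map C - (X : ℝ[X]) • B.map C).det =
      C ((-1) ^ Fintype.card n) * ∏ i, (X - C (D i)) := by
    rw [show (C (S.det ^ 2) : ℝ[X]) = C S.det * C S.det by rw [sq, C_mul]]
    calc _ = C S.det * (A.map C - (X : ℝ[X]) • B.map C).det * C S.det := by ring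
      _ = ∏ i, (C (D i) - X) := h
      _ = ∏ i, (C (-1) * (X - C (D i))) := Finset.prod_congr rfl fun i _ => by
        simp
      _ = _ := by
        rw [Finset.prod_mul_distrib, Finset.prod_const, Finset.card_univ, C_pow]
  have hroots : (A.map C - (X : ℝ[X]) • B.map C).det.roots = Finset.univ.val.map D := by
    rw [← roots_C_mul _ hS, h2, roots_C_mul _ (by simp)]
    have := roots_multiset_prod_X_sub_C (Finset.univ.val.map D)
    rwa [Multiset.map_map] at this
  rw [genEigList, ← hroots]
  congr!

theorem length_genEigList {A B : Matrix n n ℝ} (hA : A.IsHermitian) (hB : B.PosDef) :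
    (genEigList A B).length = Fintype.card n := by
  obtain ⟨S, D, hSB, hSA⟩ := exists_simultaneous_diagonalization hA hB
  simp [genEigList_eq_sort hSB hSA]

/-- The counting functions of the generalized eigenvalues are monotone in the right-hand matrix. -/
theorem card_eigenvalue_le_of_posSemidef_sub {A B B' S S' : Matrix n n ℝ} {D D' : n → ℝ}
    (hSB : Sᵀ * B * S = 1) (hSA : Sᵀ * A * S = diagonal D)
    (hSB' : S'ᵀ * B' * S' = 1) (hSA' : S'ᵀ * A * S' = diagonal D')
    (hBB : (B' - B).PosSemidef) {t : ℝ} (ht : 0 ≤ t) :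
    Fintype.card {i // D i ≤ t} ≤ Fintype.card {i // D' i ≤ t} := by
  classical
  set e : ({i // D i ≤ t} → ℝ) →ₗ[ℝ] (n → ℝ) := Function.ExtendByZero.linearMap ℝ Subtype.val
  set e' : ({i // ¬ D' i ≤ t} → ℝ) →ₗ[ℝ] (n → ℝ) := Function.ExtendByZero.linearMap ℝ Subtype.val
  have he : ∀ y i, ¬ D i ≤ t → e y i = 0 := fun y i hi =>
    Function.extend_apply' _ _ _ fun ⟨j, hj⟩ => hi (hj ▸ j.2)
  have he' : ∀ y i, D' i ≤ t → e' y i = 0 := fun y i hi =>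
    Function.extend_apply' _ _ _ fun ⟨j, hj⟩ => j.2 (hj ▸ hi)
  have heinj : ∀ y, e y = 0 → y = 0 := fun y hy => funext fun j => by
    have := congrFun hy j
    simpa [e, Subtype.val_injective.extend_apply] using this
  have heinj' : ∀ y, e' y = 0 → y = 0 := fun y hy => funext fun j => by
    have := congrFun hy j
    simpa [e', Subtype.val_injective.extend_apply] using this
  have hSB1 : Sᵀ * B * S = diagonal fun _ => (1 : ℝ) := by rw [hSB, diagonal_one]
  have hSB1' : S'ᵀ * B' * S' = diagonal fun _ => (1 : ℝ) := by rw [hSB', diagonal_one]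
  have hSinj : ∀ y, S *ᵥ y = 0 → y = 0 := fun y hy => by
    rw [← one_mulVec y, ← hSB, ← mulVec_mulVec, hy, mulVec_zero]
  -- `L` adds vectors `x` from the span of the columns of `S` with `D i ≤ t` and from that of the
  -- columns of `S'` with `D' i > t`. On the first, `xᵀAx ≤ t xᵀBx ≤ t xᵀB'x`, using `t ≥ 0`; on the
  -- second, `xᵀAx > t xᵀB'x` unless `x = 0`. So the spans meet only in zero and `L` is injective;
  -- comparing dimensions gives the count.
  set L : ({i // D i ≤ t} → ℝ) × ({i // ¬ D' i ≤ t} → ℝ) →ₗ[ℝ] (n → ℝ) :=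
    (S.mulVecLin ∘ₗ e).coprod (S'.mulVecLin ∘ₗ e')
  have hL : Function.Injective L := by
    rw [← LinearMap.ker_eq_bot, LinearMap.ker_eq_bot']
    rintro ⟨y, y'⟩ hy
    have hsum : S *ᵥ e y + S' *ᵥ e' y' = 0 := by simpa [L] using hy
    have hx : S' *ᵥ e' y' = -(S *ᵥ e y) := eq_neg_of_add_eq_zero_right hsum
    have q1 := quadratic_congruence hSA (e y)
    have q2 := quadratic_congruence hSB1 (e y)
    have q3 := quadratic_congruence hSA' (e' y')
    have q4 := quadratic_congruence hSB1' (e' y')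
    rw [hx, mulVec_neg, neg_dotProduct_neg] at q3 q4
    have hd := hBB.dotProduct_mulVec_nonneg (S *ᵥ e y)
    rw [star_trivial, sub_mulVec, dotProduct_sub, q4, q2, sub_nonneg] at hd
    have h1 : ∑ i, D i * e y i ^ 2 ≤ t * ∑ i, 1 * e y i ^ 2 := by
      rw [Finset.mul_sum]
      refine Finset.sum_le_sum fun i _ => ?_
      by_cases hi : D i ≤ t
      · rw [one_mul]; exact mul_le_mul_of_nonneg_right hi (sq_nonneg _)
      · simp [he y i hi]
    have h2 : ∑ i, (D' i - t) * e' y' i ^ 2 ≤ 0 := by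
      have : ∑ i, (D' i - t) * e' y' i ^ 2 =
          ∑ i, D' i * e' y' i ^ 2 - t * ∑ i, 1 * e' y' i ^ 2 := by
        rw [Finset.mul_sum, ← Finset.sum_sub_distrib]
        exact Finset.sum_congr rfl fun i _ => by ring
      rw [this, ← q3, q1]
      linarith [mul_le_mul_of_nonneg_left hd ht]
    have hnn : ∀ i ∈ Finset.univ, 0 ≤ (D' i - t) * e' y' i ^ 2 := fun i _ => by
      by_cases hi : D' i ≤ t
      · simp [he' y' i hi]
      · exact mul_nonneg (by linarith) (sq_nonneg _)
    have h0 := (Finset.sum_eq_zero_iff_of_nonneg hnn).1 (le_antisymm h2 (Finset.sum_nonneg hnn))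
    have hy' : e' y' = 0 := funext fun i => by
      by_cases hi : D' i ≤ t
      · exact he' y' i hi
      · have := h0 i (Finset.mem_univ i)
        rcases mul_eq_zero.1 this with h | h
        · exact absurd (by linarith) hi
        · simpa using h
    rw [hy', mulVec_zero, add_zero] at hsum
    rw [heinj y (hSinj _ hsum), heinj' y' hy']
    rfl
  have hfr := LinearMap.finrank_le_finrank_of_injective hL
  rw [Module.finrank_prod, Module.finrank_fintype_fun_eq_card, Module.finrank_fintype_fun_eq_card,
    Module.finrank_fintype_fun_eq_card, Fintype.card_subtype_compl] at hfr
  have := Fintype.card_subtype_le fun i => D' i ≤ t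
  omega

/-- Otherwise, with `t = l[k]`, at least `k + 1` entries of `l` but at most `k` entries of `l'` are
`≤ t`. -/
theorem sorted_getElem_le_of_countP_le {l l' : List ℝ} (hl : l.Pairwise (· ≤ ·))
    (hl' : l'.Pairwise (· ≤ ·)) {k : ℕ} (hk : k < l.length) (hk' : k < l'.length)
    (h : l.countP (· ≤ l[k]) ≤ l'.countP (· ≤ l[k])) : l'[k] ≤ l[k] := by
  by_contra! hlt
  have h1 : k + 1 ≤ l.countP (· ≤ l[k]) := by
    have hall : (l.take (k + 1)).countP (· ≤ l[k]) = (l.take (k + 1)).length := by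
      rw [List.countP_eq_length]
      intro a ha
      obtain ⟨i, hi, rfl⟩ := List.mem_iff_getElem.1 ha
      rw [List.length_take] at hi
      rw [List.getElem_take, decide_eq_true_eq]
      rcases (show i ≤ k by omega).lt_or_eq with h | h
      · exact List.pairwise_iff_getElem.1 hl i k _ hk h
      · subst h; exact le_rfl
    have := (List.take_sublist (k + 1) l).countP_le (p := fun x => decide (x ≤ l[k]))
    rw [hall, List.length_take] at this
    omega
  have h2 : l'.countP (· ≤ l[k]) ≤ k := by
    rw [← List.take_append_drop k l', List.countP_append]
    have hz : (l'.drop k).countP (· ≤ l[k]) = 0 := by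
      rw [List.countP_eq_zero]
      intro a ha
      obtain ⟨i, hi, rfl⟩ := List.mem_iff_getElem.1 ha
      rw [List.length_drop] at hi
      rw [List.getElem_drop, decide_eq_true_eq, not_le]
      refine hlt.trans_le ?_
      rcases Nat.eq_zero_or_pos i with h | h
      · subst h; exact le_rfl
      · exact List.pairwise_iff_getElem.1 hl' k (k + i) hk' _ (by omega)
    rw [hz, add_zero]
    exact List.countP_le_length.trans (by rw [List.length_take]; omega)
  omega

theorem genEig_antitone {A B B' : Matrix n n ℝ} (hA : A.PosSemidef) (hB : B.PosDef)
    (hB' : B'.PosDef) (hBB : (B' - B).PosSemidef) {k : ℕ} (hk : k < Fintype.card n) :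
    genEig A B' k ≤ genEig A B k := by
  obtain ⟨S, D, hSB, hSA⟩ := exists_simultaneous_diagonalization hA.isHermitian hB
  obtain ⟨S', D', hSB', hSA'⟩ := exists_simultaneous_diagonalization hA.isHermitian hB'
  have hD : ∀ i, 0 ≤ D i := by
    have := hA.conjTranspose_mul_mul_same S
    rw [conjTranspose_eq_transpose_of_trivial, hSA] at this
    exact posSemidef_diagonal_iff.1 this
  have hlen := length_genEigList hA.isHermitian hB
  have hlen' := length_genEigList hA.isHermitian hB'
  have hcount : ∀ (D : n → ℝ) (t : ℝ),
      ((Finset.univ.val.map D).sort (· ≤ ·)).countP (· ≤ t) = Fintype.card {i // D i ≤ t} := by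
    intro D t
    rw [← Multiset.coe_countP, Multiset.sort_eq, Multiset.countP_map, Fintype.card_subtype]
    rfl
  rw [genEig, genEig, List.getD_eq_getElem _ _ (hlen'.symm ▸ hk),
    List.getD_eq_getElem _ _ (hlen.symm ▸ hk)]
  apply sorted_getElem_le_of_countP_le
  · exact Multiset.pairwise_sort _ _
  · exact Multiset.pairwise_sort _ _
  · have hmem : (genEigList A B)[k]'(hlen.symm ▸ hk) ∈ genEigList A B := List.getElem_mem _
    set t := (genEigList A B)[k]'(hlen.symm ▸ hk)
    have ht : 0 ≤ t := by
      rw [genEigList_eq_sort hSB hSA, Multiset.mem_sort, Multiset.mem_map] at hmem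
      obtain ⟨i, -, hi⟩ := hmem
      exact hi ▸ hD i
    rw [genEigList_eq_sort hSB hSA, genEigList_eq_sort hSB' hSA', hcount, hcount]
    exact card_eigenvalue_le_of_posSemidef_sub hSB hSA hSB' hSA' hBB ht

theorem criticalTimeStep_mono {A B B' : Matrix n n ℝ} (hA : A.PosSemidef) (hB : B.PosDef)
    (hB' : B'.PosDef) (hBB : (B' - B).PosSemidef) :
    criticalTimeStep A B ≤ criticalTimeStep A B' := by
  unfold criticalTimeStep
  refine ENNReal.div_le_div_left (ENNReal.ofReal_le_ofReal (Real.sqrt_le_sqrt ?_)) _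
  -- With no unknowns, both lists are empty and both eigenvalues take the default value `0`.
  rcases Nat.eq_zero_or_pos (Fintype.card n) with h | h
  · have : ∀ C : Matrix n n ℝ, C.PosDef → genEigList A C = [] := fun C hC =>
      List.length_eq_zero_iff.1 ((length_genEigList hA.isHermitian hC).trans h)
    simp [genEig, this B hB, this B' hB']
  · exact genEig_antitone hA hB hB' hBB (by omega)

end Comparison

end

end SpectralFEM

end

theorem lemma3p1 {d : ℕ} {q : Fin d → ℕ} (hq : ∀ j, 1 ≤ q j)
    {E : Type*} [Fintype E] (T : SpectralFEM.Mesh d q E)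
    (Γ : Set (EuclideanSpace ℝ (Fin d)))
    (κ : EuclideanSpace ℝ (Fin d) → ℝ) (hκ : ∀ x ∈ T.domain, 0 < κ x)
    (hκint : MeasureTheory.IntegrableOn κ T.domain)
    (ρ : EuclideanSpace ℝ (Fin d) → ℝ) (ρe : E → ℝ)
    (hρ : ∀ e, ∀ x ∈ interior (T.element e), ρ x = ρe e) (hρpos : ∀ e, 0 < ρe e) :
    (T.massMatrix Γ ρ).PosDef ∧ (T.lumpedMatrix Γ ρe).PosDef ∧
    (T.lumpedMatrix Γ ρe - T.massMatrix Γ ρ).PosSemidef ∧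
    (SpectralFEM.genEigList (T.stiffMatrix Γ κ) (T.massMatrix Γ ρ)).length
      = (T.freeNodes Γ).card ∧
    (SpectralFEM.genEigList (T.stiffMatrix Γ κ) (T.lumpedMatrix Γ ρe)).length
      = (T.freeNodes Γ).card ∧
    (∀ k < (T.freeNodes Γ).card,
      SpectralFEM.genEig (T.stiffMatrix Γ κ) (T.lumpedMatrix Γ ρe) k
        ≤ SpectralFEM.genEig (T.stiffMatrix Γ κ) (T.massMatrix Γ ρ) k) ∧
    SpectralFEM.criticalTimeStep (T.stiffMatrix Γ κ) (T.massMatrix Γ ρ)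
      ≤ SpectralFEM.criticalTimeStep (T.stiffMatrix Γ κ) (T.lumpedMatrix Γ ρe) := by
  classical
  have hM := T.massMatrix_posDef Γ hq hρ hρpos
  have hsub := T.lumpedMatrix_sub_massMatrix_posSemidef Γ hq hρ hρpos
  -- Definiteness is inherited from the smaller matrix, so positivity of the quadrature weights need
  -- not be proved.
  have hL : (T.lumpedMatrix Γ ρe).PosDef := by
    have := hM.add_posSemidef hsub
    rwa [add_sub_cancel] at this
  have hK := T.stiffMatrix_posSemidef Γ hκ hκint
  have hcard : Fintype.card (T.freeNodes Γ) = (T.freeNodes Γ).card := Fintype.card_coe _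
  refine ⟨hM, hL, hsub, ?_, ?_, fun k hk => ?_, ?_⟩
  · rw [SpectralFEM.length_genEigList hK.isHermitian hM, hcard]
  · rw [SpectralFEM.length_genEigList hK.isHermitian hL, hcard]
  · exact SpectralFEM.genEig_antitone hK hM hL hsub (hcard ▸ hk)
  · exact SpectralFEM.criticalTimeStep_mono hK hM hL hsub
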